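/- **Model.** A source transmits with power $P_s>0$ to a relay at distance $d_1>0$; the relay, powered only by energy harvested with efficiency $\eta\in(0,1)$ from the source signal and stored in an infinite battery, forwards to a destination at distance $d_2>0$ with fixed power $P_r>0$ (decode-and-forward). The path loss exponent is $m$, the noise variances at relay and destination are $\sigma_{n_r}^2,\sigma_{n_d}^2>0$, the SNR threshold is $\gamma_o>0$, and time is divided into blocks of $T>0$ seconds. The channel gains $h_i$ (source-relay) and $g_i$ (relay-destination), $i=0,1,2,\dots$, are all independent circularly symmetric complex Gaussian variables with mean $0$ and variance $1$. Put $$\bar a=\frac{\gamma_o d_1^m\sigma_{n_r}^2}{P_s},\qquad \bar b=\frac{\gamma_o d_2^m\sigma_{n_d}^2}{P_r}.$$ **Protocol 3.** Let $E_i(0)$ be the stored energy at the start of block $i$; $E_0(0)\ge 0$ is an arbitrary random variable. The fraction $\alpha_i$ of block $i$ that is spent harvesting, and the energy $E_{i+1}(0)=E_i(T)$ left at its end, are * $\alpha_i=1$ and $E_i(T)=E_i(0)+\eta P_s|h_i|^2T/d_1^m$, if $|h_i|^2<\bar a$ (relay outage: the whole block is spent harvesting); * $\alpha_i=0$ and $E_i(T)=E_i(0)-P_rT/2$,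 if $|h_i|^2\ge\bar a$ and $E_i(0)\ge P_rT/2$; * $\alpha_i=\dfrac{d_1^mP_rT-2E_i(0)d_1^m}{2\eta P_s|h_i|^2T+d_1^mP_rT}$ and $E_i(T)=0$, if $|h_i|^2\ge\bar a$ and $E_i(0)<P_rT/2$. The block throughput is $\tau_i=\frac12\,\mathbf 1(|g_i|^2\ge\bar b)\,(1-\alpha_i)$, and the throughput is $\tau=\liminf_{i\to\infty}\mathbb E\{\tau_i\}$. Let $\tilde\tau$ be the throughput of the variant in which the energy left after a transmission is discarded, i.e. $E_i(T)=0$ whenever $|h_i|^2\ge\bar a$, so that every pattern (a run of relay-outage blocks followed by a transmitting block) after the first starts with zero leftover energy. **Theorem.** The series below converges, and $$\tau\ \ge\ \tilde\tau\ \ge\ \frac{e^{-(\bar a+\bar b)}}{4\eta P_s}\sum_{n=0}^{\infty}\Big(2\eta P_s\,e^{-\bar a}(1-e^{-\bar a})^{n-1}(1-e^{-q})-e^{\frac{d_1^mP_r-2\eta P_s((n-1)\bar a+q)}{2\eta P_s}}(e^{\bar a}-1)^{n-1}\big(2n\eta P_sq-d_1^mP_r+2n\eta P_s+(d_1^mP_r-2n\eta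 P_s)e^{q}\big)E_1\Big(\tfrac{d_1^mP_r+2\eta P_s\bar a}{2\eta P_s}\Big)\Big),$$ where $q=q_n=\min\big(\bar a,\frac{d_1^mP_r}{2\eta P_sn}\big)$ (with $q_0=\bar a$) and $E_1(x)=\int_x^\infty\frac{e^{-t}}{t}\,dt$. -/

import Mathlib

open MeasureTheory ProbabilityTheory Filter

noncomputable section

/-- The physical parameters of a source - relay - destination link with an
energy-harvesting relay. -/
structure RelayLink where
  /-- source transmission power -/
  Ps : ℝ
  /-- preset relay transmission power -/
  Pr : ℝ
  /-- energy conversion efficiency -/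
  η : ℝ
  /-- source-to-relay distance -/
  d₁ : ℝ
  /-- relay-to-destination distance -/
  d₂ : ℝ
  /-- path loss exponent -/
  m : ℝ
  /-- noise variance at the relay -/
  varR : ℝ
  /-- noise variance at the destination -/
  varD : ℝ
  /-- threshold signal-to-noise ratio -/
  γo : ℝ
  /-- block time -/
  T : ℝ
  Ps_pos : 0 < Ps
  Pr_pos : 0 < Pr
  η_pos : 0 < η
  η_lt_one : η < 1
  d₁_pos : 0 < d₁
  d₂_pos : 0 < d₂
  varR_pos : 0 < varR
  varD_pos : 0 < varD
  γo_pos : 0 < γo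
  T_pos : 0 < T

/-- The law of a circularly symmetric complex Gaussian variable with zero mean and unit variance:
real and imaginary part are independent, each normal with mean `0` and variance `1 / 2`. -/
def stdComplexGaussian : Measure ℂ :=
  ((gaussianReal 0 (1 / 2)).prod (gaussianReal 0 (1 / 2))).map
    Complex.measurableEquivRealProd.symm

/-- The exponential integral `E₁(x) = ∫_x^∞ e^{-t} / t dt`. -/
def expIntegralE1 (x : ℝ) : ℝ := ∫ t in Set.Ioi x, Real.exp (-t) / t

namespace RelayLink

variable (L : RelayLink)

/-- Signal-to-noise ratio at the relay, for the source-to-relay channel gain `h`. -/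
def snrRelay (h : ℂ) : ℝ := L.Ps * ‖h‖ ^ 2 / (L.d₁ ^ L.m * L.varR)

/-- Signal-to-noise ratio at the destination, for the relay-to-destination channel gain `g`. -/
def snrDest (g : ℂ) : ℝ := L.Pr * ‖g‖ ^ 2 / (L.d₂ ^ L.m * L.varD)

open Classical in
/-- Outage indicator of the relay-to-destination link. -/
def outageInd (g : ℂ) : ℝ := if L.snrDest g < L.γo then 1 else 0

open Classical in
/-- Fraction `α` of the block time spent harvesting, in a block that starts with stored energy `E`
and has source-to-relay gain `h`: the whole block if the relay is in outage; nothing if the stored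
energy suffices for a whole block of transmission (half of it by the relay); otherwise the `α` with
`η Pₛ |h|² / d₁^m * α T + E = Pᵣ (1 - α) T / 2`. -/
def harvestFraction (E : ℝ) (h : ℂ) : ℝ :=
  if L.snrRelay h < L.γo then 1
  else if L.Pr * L.T / 2 ≤ E then 0
  else (L.d₁ ^ L.m * L.Pr * L.T - 2 * E * L.d₁ ^ L.m) /
    (2 * L.η * L.Ps * ‖h‖ ^ 2 * L.T + L.d₁ ^ L.m * L.Pr * L.T)

open Classical in
/-- Stored energy at the end of a block of the protocol. In an EH block (`α = 1`) the harvested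
energy is added; an IT block (`α = 0`) consumes `Pᵣ T / 2`; an EH-IT block (`0 < α < 1`) uses up
everything. -/
def energyStep (E : ℝ) (h : ℂ) : ℝ :=
  if L.snrRelay h < L.γo then E + L.η * L.Ps * ‖h‖ ^ 2 / L.d₁ ^ L.m * L.T
  else if L.Pr * L.T / 2 ≤ E then E - L.Pr * L.T / 2
  else 0

open Classical in
/-- Stored energy at the end of a block in the variant of the protocol where energy left over
after a transmission is discarded: every EH-IT pattern starts with empty storage. -/
def energyStepReset (E : ℝ) (h : ℂ) : ℝ :=
  if L.snrRelay h < L.γo then E + L.η * L.Ps * ‖h‖ ^ 2 / L.d₁ ^ L.m * L.T else 0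

/-- Stored energy at the start of block `i`, when blocks `0, 1, 2, …` have source-to-relay gains
`h 0, h 1, h 2, …`, block `0` starts with energy `E₀` and `step` is the energy update. -/
def energy (step : ℝ → ℂ → ℝ) (h : ℕ → ℂ) (E₀ : ℝ) : ℕ → ℝ
  | 0 => E₀
  | i + 1 => step (energy step h E₀ i) (h i)

/-- Block throughput: the fraction of the block in which information successfully reaches the
destination, `(1 - I) (1 - α) / 2`. -/
def blockThroughput (E : ℝ) (h g : ℂ) : ℝ :=
  (1 - L.outageInd g) * (1 - L.harvestFraction E h) / 2

/-- Throughput: the expected block throughput `𝔼 τᵢ` in the long run. The lower limit is at most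
the limit of time averages, and equals `𝔼 τᵢ` when the latter does not depend on `i`. -/
def throughput (step : ℝ → ℂ → ℝ) {Ω : Type*} [MeasurableSpace Ω] (P : Measure Ω)
    (h g : ℕ → Ω → ℂ) (E₀ : Ω → ℝ) : ℝ :=
  liminf (fun i : ℕ =>
    ∫ ω, L.blockThroughput (energy step (fun j => h j ω) (E₀ ω) i) (h i ω) (g i ω) ∂P) atTop

/-- `ā = γₒ d₁^m σᵣ² / Pₛ`. -/
def aBar : ℝ := L.γo * L.d₁ ^ L.m * L.varR / L.Ps

/-- `b̄ = γₒ d₂^m σ_d² / Pᵣ`. -/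
def bBar : ℝ := L.γo * L.d₂ ^ L.m * L.varD / L.Pr

/-- `q = min (ā, d₁^m Pᵣ / (2 η Pₛ n))`, where the second entry is `+∞` for `n = 0`. -/
def q (n : ℕ) : ℝ :=
  if n = 0 then L.aBar else min L.aBar (L.d₁ ^ L.m * L.Pr / (2 * L.η * L.Ps * n))

/-- The `n`-th term of the series in the lower bound. -/
def boundTerm (n : ℕ) : ℝ :=
  2 * L.η * L.Ps * (Real.exp (-L.aBar) * (1 - Real.exp (-L.aBar)) ^ ((n : ℤ) - 1) *
      (1 - Real.exp (-L.q n)))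
    - Real.exp ((L.d₁ ^ L.m * L.Pr - 2 * L.η * L.Ps * (((n : ℝ) - 1) * L.aBar + L.q n)) /
        (2 * L.η * L.Ps)) * (Real.exp L.aBar - 1) ^ ((n : ℤ) - 1) *
      (2 * n * L.η * L.Ps * L.q n - L.d₁ ^ L.m * L.Pr + 2 * n * L.η * L.Ps +
        (L.d₁ ^ L.m * L.Pr - 2 * n * L.η * L.Ps) * Real.exp (L.q n)) *
      expIntegralE1 ((L.d₁ ^ L.m * L.Pr + 2 * L.η * L.Ps * L.aBar) / (2 * L.η * L.Ps))

end RelayLink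

end

/-! In terms of squared gains, which are exponential with mean 1, a block of the reset variant with
gain `x ≥ ā` that follows `n` outage blocks with gains `y_j`, themselves preceded by a transmitting
block, transmits for the fraction `min 1 ((x + ∑ y_j) / (x + ρ))`, where `ρ = d₁^m Pᵣ / (2 η Pₛ)`.
The mean of this has no simple form, because the minimum couples all the gains.

Write `∑ y_j` as the average of the numbers `n * y_k`. By concavity of `min 1`, the fraction is at
least the average over `k` of `min 1 ((x + n y_k) / (x + ρ))`. Replace each of these by 0 unless
`y_k < q`. Since `n q ≤ ρ`, the surviving value is `(x + n y_k) / (x + ρ) = 1 + (n y_k - ρ) / (x +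
ρ)`, a sum of products of one-variable functions (`patternBound`, `patternBound_le`). Independence
then turns means into products of elementary integrals, and `E₁` enters through the mean of `1 / (x
+ ρ)` on `x ≥ ā`. The result is the `n`-th term of the series
(`integrable_and_integral_patternThroughput`).

For a fixed block the patterns with different `n` are disjoint events, so the first `N` terms add up
to at most `𝔼 τᵢ` once `i ≥ N`. As the terms are nonnegative and `𝔼 τᵢ ≤ 1/2`, the series converges,
and its sum is at most the lower limit. The comparison of the two protocols is pathwise: discarding
energy never leaves more in the battery, and block throughput increases with stored energy. -/

/-- The squared modulus of a standard complex Gaussian variable is exponential with mean `1`. -/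
theorem integral_sq_norm_stdComplexGaussian (f : ℝ → ℝ) :
    ∫ z, f (‖z‖ ^ 2) ∂stdComplexGaussian = ∫ u in Set.Ioi (0 : ℝ), Real.exp (-u) * f u := by
  have hv : (1 / 2 : NNReal) ≠ 0 := by norm_num
  rw [stdComplexGaussian, integral_map_equiv, gaussianReal_of_var_ne_zero _ hv,
    prod_withDensity (measurable_gaussianPDF _ _) (measurable_gaussianPDF _ _),
    integral_withDensity_eq_integral_toReal_smul]
  rotate_left
  · exact ((measurable_gaussianPDF _ _).comp measurable_fst).mul
      ((measurable_gaussianPDF _ _).comp measurable_snd)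
  · exact Eventually.of_forall fun x => ENNReal.mul_lt_top (by simp [gaussianPDF])
      (by simp [gaussianPDF])
  have hdens : ∀ x : ℝ × ℝ, (gaussianPDF 0 (1 / 2) x.1 * gaussianPDF 0 (1 / 2) x.2).toReal •
      f (‖Complex.measurableEquivRealProd.symm x‖ ^ 2) =
      Real.pi⁻¹ * (Real.exp (-(x.1 ^ 2 + x.2 ^ 2)) * f (x.1 ^ 2 + x.2 ^ 2)) := by
    intro x
    have hn : ‖Complex.measurableEquivRealProd.symm x‖ ^ 2 = x.1 ^ 2 + x.2 ^ 2 := by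
      rw [Complex.sq_norm, Complex.normSq_apply, Complex.measurableEquivRealProd_symm_apply]
      ring
    rw [hn, ENNReal.toReal_mul, toReal_gaussianPDF, toReal_gaussianPDF, gaussianPDFReal,
      gaussianPDFReal]
    have h2 : (2 : ℝ) * Real.pi * ((1 / 2 : NNReal) : ℝ) = Real.pi := by push_cast; ring
    have h3 : (2 : ℝ) * ((1 / 2 : NNReal) : ℝ) = 1 := by push_cast; ring
    rw [h2, h3, neg_add, Real.exp_add]
    have h4 : (√Real.pi)⁻¹ * (√Real.pi)⁻¹ = Real.pi⁻¹ := by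
      rw [← mul_inv, Real.mul_self_sqrt Real.pi_pos.le]
    simp only [sub_zero, div_one, smul_eq_mul]
    rw [← h4]
    ring
  simp_rw [hdens]
  -- The joint density is `π⁻¹ e^{-|z|²}`. Polar coordinates followed by the substitution `u = r²`
  -- reduce the integral to one over `u`; the angle contributes `2π`.
  rw [integral_const_mul, ← Measure.volume_eq_prod,
    ← integral_comp_polarCoord_symm (fun x : ℝ × ℝ =>
      Real.exp (-(x.1 ^ 2 + x.2 ^ 2)) * f (x.1 ^ 2 + x.2 ^ 2))]
  have hpol : ∀ p : ℝ × ℝ, p.1 • (Real.exp (-((polarCoord.symm p).1 ^ 2 +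
      (polarCoord.symm p).2 ^ 2)) * f ((polarCoord.symm p).1 ^ 2 + (polarCoord.symm p).2 ^ 2)) =
      (p.1 * (Real.exp (-p.1 ^ 2) * f (p.1 ^ 2))) * 1 := by
    intro p
    have : (polarCoord.symm p).1 ^ 2 + (polarCoord.symm p).2 ^ 2 = p.1 ^ 2 := by
      simp only [polarCoord_symm_apply]
      linear_combination p.1 ^ 2 * Real.sin_sq_add_cos_sq p.2
    rw [this]; simp
  simp_rw [hpol]
  rw [polarCoord_target, Measure.volume_eq_prod,
    setIntegral_prod_mul (fun r : ℝ => r * (Real.exp (-r ^ 2) * f (r ^ 2))) (fun _ => (1 : ℝ)),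
    ← integral_comp_rpow_Ioi_of_pos (g := fun u => Real.exp (-u) * f u) (p := 2) two_pos]
  have hθ : ∫ _ in Set.Ioo (-Real.pi) Real.pi, (1 : ℝ) = 2 * Real.pi := by
    simp [Real.pi_pos.le]; ring
  have hr : ∀ x : ℝ, (2 * x ^ ((2 : ℝ) - 1)) • (Real.exp (-x ^ (2 : ℝ)) * f (x ^ (2 : ℝ))) =
      2 * (x * (Real.exp (-x ^ 2) * f (x ^ 2))) := by
    intro x
    norm_num
    ring
  simp_rw [hr]
  rw [hθ, integral_const_mul]
  field_simp

/-! ### Integrals against the exponential density -/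

section ExponentialIntegrals

variable {a q ρ : ℝ}

theorem setIntegral_Ioi_exp_neg_mul_indicator_Ici (ha : 0 < a) (f : ℝ → ℝ) :
    ∫ u in Set.Ioi (0 : ℝ), Real.exp (-u) * (Set.Ici a).indicator f u =
      ∫ u in Set.Ioi a, Real.exp (-u) * f u := by
  rw [← integral_Ici_eq_integral_Ioi (x := a)]
  have : ∀ u, Real.exp (-u) * (Set.Ici a).indicator f u =
      (Set.Ici a).indicator (fun u => Real.exp (-u) * f u) u := fun u => by
    by_cases h : u ∈ Set.Ici a <;> simp [h]
  simp_rw [this]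
  rw [setIntegral_indicator measurableSet_Ici]
  rw [Set.inter_eq_right.2 (Set.Ici_subset_Ioi.2 ha)]

theorem setIntegral_Ioi_exp_neg_mul_indicator_Iio (hq : 0 ≤ q) (f : ℝ → ℝ) :
    ∫ u in Set.Ioi (0 : ℝ), Real.exp (-u) * (Set.Iio q).indicator f u =
      ∫ u in (0 : ℝ)..q, Real.exp (-u) * f u := by
  rw [intervalIntegral.integral_of_le hq, integral_Ioc_eq_integral_Ioo]
  have : ∀ u, Real.exp (-u) * (Set.Iio q).indicator f u =
      (Set.Iio q).indicator (fun u => Real.exp (-u) * f u) u := fun u => by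
    by_cases h : u ∈ Set.Iio q <;> simp [h]
  simp_rw [this]
  rw [setIntegral_indicator measurableSet_Iio, Set.Ioi_inter_Iio]

theorem intervalIntegral_exp_neg_mul_affine (c d : ℝ) :
    ∫ u in (0 : ℝ)..q, Real.exp (-u) * (c * u - d) =
      c * (1 - Real.exp (-q) - q * Real.exp (-q)) - d * (1 - Real.exp (-q)) := by
  have hd : ∀ u : ℝ, HasDerivAt (fun u : ℝ => -Real.exp (-u) * (c * u - d + c))
      (Real.exp (-u) * (c * u - d)) u := by
    intro u
    have h1 : HasDerivAt (fun u : ℝ => -Real.exp (-u)) (Real.exp (-u)) u :=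
      ((hasDerivAt_neg u).exp.neg).congr_deriv (by simp)
    have h2 : HasDerivAt (fun u : ℝ => c * u - d + c) c u := by
      simpa using (((hasDerivAt_id u).const_mul c).sub_const d).add_const c
    exact (h1.mul h2).congr_deriv (by ring)
  rw [intervalIntegral.integral_eq_sub_of_hasDerivAt (fun u _ => hd u)
    (Continuous.intervalIntegrable (by fun_prop) _ _)]
  simp
  ring

/-- The translation `t = u + ρ` turns the integrand into `e^ρ e^{-t} / t`. This is the only source
of `E₁` in the bound. -/
theorem setIntegral_Ioi_exp_neg_div_add :
    ∫ u in Set.Ioi a, Real.exp (-u) * (1 / (u + ρ)) = Real.exp ρ * expIntegralE1 (ρ + a) := by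
  have h := (measurePreserving_add_right (volume : Measure ℝ) ρ).setIntegral_preimage_emb
    (measurableEmbedding_addRight ρ) (fun t => Real.exp (-t) / t) (Set.Ioi (ρ + a))
  have hs : (fun x => x + ρ) ⁻¹' Set.Ioi (ρ + a) = Set.Ioi a := by
    ext x; simp [add_comm ρ a]
  rw [hs] at h
  rw [expIntegralE1, ← h, ← integral_const_mul]
  congr 1
  ext u
  rw [neg_add, Real.exp_add, Real.exp_neg ρ]
  have := Real.exp_ne_zero ρ
  field_simp

end ExponentialIntegrals

/-- The mean of `f` under the exponential law with mean `1`. -/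
noncomputable def expMean (f : ℝ → ℝ) : ℝ := ∫ u in Set.Ioi (0 : ℝ), Real.exp (-u) * f u

/-! ### Means of products of functions of independent gains -/

section ProductMeans

variable {Ω : Type*} [MeasurableSpace Ω] {P : Measure Ω} {h g : ℕ → Ω → ℂ}

theorem integral_sq_norm_gain {z : Ω → ℂ} (hz : Measurable z)
    (hlaw : P.map z = stdComplexGaussian) {f : ℝ → ℝ} (hf : Measurable f) :
    ∫ ω, f (‖z ω‖ ^ 2) ∂P = expMean f := by
  rw [expMean, ← integral_sq_norm_stdComplexGaussian, ← hlaw, integral_map hz.aemeasurable]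
  exact (hf.comp (by fun_prop)).aestronglyMeasurable

theorem integral_mul_prod_gains
    (h_meas : ∀ i, Measurable (h i)) (g_meas : ∀ i, Measurable (g i))
    (h_law : ∀ i, P.map (h i) = stdComplexGaussian)
    (g_law : ∀ i, P.map (g i) = stdComplexGaussian)
    (h_g_indep : iIndepFun (Sum.elim h g : ℕ ⊕ ℕ → Ω → ℂ) P)
    {G : ℝ → ℝ} (hG : Measurable G) {F : ℕ → ℝ → ℝ} (hF : ∀ j, Measurable (F j)) (i p N : ℕ) :
    ∫ ω, G (‖g i ω‖ ^ 2) * ∏ j ∈ Finset.range N, F j (‖h (p + j) ω‖ ^ 2) ∂P =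
      expMean G * ∏ j ∈ Finset.range N, expMean (F j) := by
  -- `none` stands for the single destination gain and `some j` for the `j`-th relay gain of the
  -- window. Injectivity of this indexing passes joint independence to the finite subfamily.
  let e : Option (Fin N) → ℕ ⊕ ℕ := fun o => o.elim (Sum.inr i) fun j => Sum.inl (p + j)
  have he : Function.Injective e := by
    rintro (_ | x) (_ | y) hxy
    · rfl
    · simp [e] at hxy
    · simp [e] at hxy
    · simp only [e, Option.elim_some, Sum.inl.injEq] at hxy
      exact congrArg some (Fin.ext (by omega))
  let φ : Option (Fin N) → ℂ → ℝ := fun o z => o.elim (G (‖z‖ ^ 2)) fun j => F j (‖z‖ ^ 2)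
  have hφ : ∀ o, Measurable (φ o) := by
    rintro (_ | j)
    · exact hG.comp (by fun_prop)
    · exact (hF j).comp (by fun_prop)
  have hm : ∀ s, Measurable ((Sum.elim h g : ℕ ⊕ ℕ → Ω → ℂ) s) := by
    rintro (j | j)
    · exact h_meas j
    · exact g_meas j
  have hind := (h_g_indep.precomp he).comp φ hφ
  have := hind.integral_fun_prod_eq_prod_integral
    (fun o => ((hφ o).comp (hm (e o))).aestronglyMeasurable)
  simp only [Fintype.prod_option, Function.comp_apply] at this
  simp only [φ, e, Option.elim_some, Option.elim_none, Sum.elim_inl, Sum.elim_inr] at this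
  rw [integral_sq_norm_gain (g_meas i) (g_law i) hG] at this
  simp_rw [fun j : Fin N => integral_sq_norm_gain (h_meas (p + j)) (h_law (p + j)) (hF j)] at this
  rw [Finset.prod_range, ← this]
  simp_rw [Finset.prod_range]

/-- The factors follow the shape of a pattern: `W` sees the transmitting block `p`, the `V j` see
the outage run after it, and `u` and `G` see the two links at the closing block. -/
theorem integral_pattern_gains
    (h_meas : ∀ i, Measurable (h i)) (g_meas : ∀ i, Measurable (g i))
    (h_law : ∀ i, P.map (h i) = stdComplexGaussian)
    (g_law : ∀ i, P.map (g i) = stdComplexGaussian)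
    (h_g_indep : iIndepFun (Sum.elim h g : ℕ ⊕ ℕ → Ω → ℂ) P)
    {G W u : ℝ → ℝ} (hG : Measurable G) (hW : Measurable W) (hu : Measurable u)
    {V : ℕ → ℝ → ℝ} (hV : ∀ j, Measurable (V j)) (i p n : ℕ) :
    ∫ ω, G (‖g i ω‖ ^ 2) * (W (‖h p ω‖ ^ 2) *
        (∏ j ∈ Finset.range n, V j (‖h (p + (j + 1)) ω‖ ^ 2)) * u (‖h (p + (n + 1)) ω‖ ^ 2)) ∂P =
      expMean G * (expMean W * (∏ j ∈ Finset.range n, expMean (V j)) * expMean u) := by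
  let F : ℕ → ℝ → ℝ := fun j => Nat.casesOn j W fun j => if j < n then V j else u
  have hF : ∀ j, Measurable (F j) := by
    rintro (_ | j)
    · exact hW
    · by_cases hj : j < n
      · simpa [F, hj] using hV j
      · simpa [F, hj] using hu
  -- Stated for a general `Φ` so that the same splitting serves both for the means and for the
  -- pointwise values.
  have key : ∀ (Φ : (ℝ → ℝ) → ℕ → ℝ), ∏ j ∈ Finset.range (n + 2), Φ (F j) j =
      Φ W 0 * (∏ j ∈ Finset.range n, Φ (V j) (j + 1)) * Φ u (n + 1) := by
    intro Φ
    rw [Finset.prod_range_succ, Finset.prod_range_succ', mul_comm (Finset.prod _ _) (Φ (F 0) 0)]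
    congr 2
    · refine Finset.prod_congr rfl fun j hj => ?_
      simp [F, Finset.mem_range.1 hj]
    · simp [F]
  have := integral_mul_prod_gains h_meas g_meas h_law g_law h_g_indep hG hF i p (n + 2)
  rw [key fun f _ => expMean f] at this
  rw [← this]
  congr 1
  ext ω
  rw [key fun f j => f (‖h (p + j) ω‖ ^ 2)]
  simp

end ProductMeans

section ExpMeans

variable {a q ρ : ℝ}

theorem expMean_indicator_Ici_one (ha : 0 < a) :
    expMean ((Set.Ici a).indicator fun _ => 1) = Real.exp (-a) := by
  rw [expMean, setIntegral_Ioi_exp_neg_mul_indicator_Ici ha]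
  simpa using integral_exp_neg_Ioi a

theorem expMean_indicator_Iio_affine (hq : 0 ≤ q) (c d : ℝ) :
    expMean ((Set.Iio q).indicator fun u => c * u - d) =
      c * (1 - Real.exp (-q) - q * Real.exp (-q)) - d * (1 - Real.exp (-q)) := by
  rw [expMean, setIntegral_Ioi_exp_neg_mul_indicator_Iio hq, intervalIntegral_exp_neg_mul_affine]

theorem expMean_indicator_Iio_one (hq : 0 ≤ q) :
    expMean ((Set.Iio q).indicator fun _ => 1) = 1 - Real.exp (-q) := by
  simpa using expMean_indicator_Iio_affine hq 0 (-1)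

theorem expMean_indicator_Ici_one_div (ha : 0 < a) :
    expMean ((Set.Ici a).indicator fun u => 1 / (u + ρ)) =
      Real.exp ρ * expIntegralE1 (ρ + a) := by
  rw [expMean, setIntegral_Ioi_exp_neg_mul_indicator_Ici ha, setIntegral_Ioi_exp_neg_div_add]

end ExpMeans

/-! ### The separable lower bound for the transmitting fraction -/

section PatternBound

/-- A lower bound, affine in products of one-variable functions, for the fraction of a block that
transmits when `n` outage blocks with gains `y 0, …, y (n - 1)` precede a block with gain `x`. -/
noncomputable def patternBound (a ρ q : ℝ) (n : ℕ) (y : ℕ → ℝ) (x : ℝ) : ℝ :=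
  if n = 0 then (Set.Ici a).indicator (fun _ => 1) x -
    ρ * (Set.Ici a).indicator (fun u => 1 / (u + ρ)) x
  else (n : ℝ)⁻¹ * ∑ k ∈ Finset.range n,
    ((∏ j ∈ Finset.range n, (if j = k then (Set.Iio q).indicator fun _ => 1
        else (Set.Iio a).indicator fun _ => (1 : ℝ)) (y j)) *
        (Set.Ici a).indicator (fun _ => 1) x +
      (∏ j ∈ Finset.range n, (if j = k then (Set.Iio q).indicator fun u => n * u - ρ
        else (Set.Iio a).indicator fun _ => (1 : ℝ)) (y j)) *
        (Set.Ici a).indicator (fun u => 1 / (u + ρ)) x)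

variable {a ρ q : ℝ} {n : ℕ} {y : ℕ → ℝ} {x : ℝ}

theorem prod_ite_apply_eq_mul_prod_erase (v w : ℝ → ℝ) {k : ℕ} (hk : k ∈ Finset.range n) :
    ∏ j ∈ Finset.range n, (if j = k then v else w) (y j) =
      v (y k) * ∏ j ∈ (Finset.range n).erase k, w (y j) := by
  rw [← Finset.mul_prod_erase _ _ hk]
  congr 1
  · simp
  · exact Finset.prod_congr rfl fun j hj => by rw [if_neg (Finset.ne_of_mem_erase hj)]

theorem prod_indicator_Iio_eq_zero {s : Finset ℕ} {i : ℕ} (hi : i ∈ s) (h : a ≤ y i) :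
    ∏ j ∈ s, (Set.Iio a).indicator (fun _ => (1 : ℝ)) (y j) = 0 :=
  Finset.prod_eq_zero hi (Set.indicator_of_notMem (by simpa using h) _)

theorem prod_indicator_Iio_eq_one {s : Finset ℕ} (h : ∀ j ∈ s, y j < a) :
    ∏ j ∈ s, (Set.Iio a).indicator (fun _ => (1 : ℝ)) (y j) = 1 :=
  Finset.prod_eq_one fun j hj => Set.indicator_of_mem (by simpa using h j hj) _

theorem patternBound_of_lt (hx : x < a) : patternBound a ρ q n y x = 0 := by
  have : x ∉ Set.Ici a := by simpa using hx
  simp [patternBound, this]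

theorem patternBound_of_ne_zero (hn : n ≠ 0) (hx : a ≤ x) :
    patternBound a ρ q n y x = (n : ℝ)⁻¹ * ∑ k ∈ Finset.range n,
      (Set.Iio q).indicator (fun u => 1 + (n * u - ρ) * (1 / (x + ρ))) (y k) *
        ∏ j ∈ (Finset.range n).erase k, (Set.Iio a).indicator (fun _ => (1 : ℝ)) (y j) := by
  rw [patternBound, if_neg hn]
  congr 1
  refine Finset.sum_congr rfl fun k hk => ?_
  rw [prod_ite_apply_eq_mul_prod_erase _ _ hk, prod_ite_apply_eq_mul_prod_erase _ _ hk]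
  have hx' : x ∈ Set.Ici a := hx
  by_cases hy : y k ∈ Set.Iio q
  · simp only [hy, hx', Set.indicator_of_mem]; ring
  · simp [hy]

theorem patternBound_nonneg (ha : 0 < a) (hρ : 0 < ρ) (hy : ∀ j, 0 ≤ y j) :
    0 ≤ patternBound a ρ q n y x := by
  rcases lt_or_ge x a with hx | hx
  · rw [patternBound_of_lt hx]
  have hxρ : 0 < x + ρ := by linarith
  by_cases hn : n = 0
  · have hx' : x ∈ Set.Ici a := hx
    simp only [patternBound, if_pos hn, hx', Set.indicator_of_mem]
    rw [mul_one_div, sub_nonneg, div_le_one hxρ]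
    linarith
  · rw [patternBound_of_ne_zero hn hx]
    refine mul_nonneg (by positivity) (Finset.sum_nonneg fun k _ => mul_nonneg ?_
      (Finset.prod_nonneg fun j _ => Set.indicator_nonneg (fun _ _ => zero_le_one) _))
    refine Set.indicator_apply_nonneg fun _ => ?_
    have : 1 + (n * y k - ρ) * (1 / (x + ρ)) = (x + n * y k) / (x + ρ) := by
      field_simp; ring
    rw [this]
    have := hy k
    have : 0 ≤ x := by linarith
    positivity

/-- This is the concavity argument. Off the event that all `y j` lie below `a` both sides vanish; `q
≤ a` is what kills the summand whose marked index is the offending one. On the event, `n * q ≤ ρ`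
keeps each surviving summand at most 1. -/
theorem patternBound_le (ha : 0 < a) (hρ : 0 < ρ) (hqa : q ≤ a) (hqn : n * q ≤ ρ)
    (hy : ∀ j, 0 ≤ y j) :
    patternBound a ρ q n y x ≤ (∏ j ∈ Finset.range n, (Set.Iio a).indicator (fun _ => 1) (y j)) *
      (Set.Ici a).indicator (fun x => min 1 ((x + ∑ j ∈ Finset.range n, y j) / (x + ρ))) x := by
  rcases lt_or_ge x a with hx | hx
  · rw [patternBound_of_lt hx, Set.indicator_of_notMem (by simpa using hx), mul_zero]
  have hx' : x ∈ Set.Ici a := hx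
  have hx0 : 0 < x := by linarith
  have hxρ : 0 < x + ρ := by linarith
  rw [Set.indicator_of_mem hx']
  by_cases hn : n = 0
  · subst hn
    simp only [patternBound, if_true, hx', Set.indicator_of_mem, Finset.range_zero,
      Finset.prod_empty, Finset.sum_empty, one_mul, add_zero]
    refine le_min ?_ (le_of_eq ?_)
    · have : 0 ≤ ρ * (1 / (x + ρ)) := by positivity
      linarith
    · field_simp; ring
  rw [patternBound_of_ne_zero hn hx]
  have hn' : (0 : ℝ) < n := by positivity
  by_cases hall : ∀ j ∈ Finset.range n, y j < a
  · have hone : ∀ s ⊆ Finset.range n,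
        ∏ j ∈ s, (Set.Iio a).indicator (fun _ => (1 : ℝ)) (y j) = 1 := fun s hs =>
      prod_indicator_Iio_eq_one fun j hj => hall j (hs hj)
    rw [hone _ subset_rfl, one_mul, inv_mul_le_iff₀ hn']
    have hle : ∀ k ∈ Finset.range n,
        (Set.Iio q).indicator (fun u => 1 + (n * u - ρ) * (1 / (x + ρ))) (y k) *
          ∏ j ∈ (Finset.range n).erase k, (Set.Iio a).indicator (fun _ => (1 : ℝ)) (y j) ≤
        min 1 ((x + n * y k) / (x + ρ)) := by
      intro k _
      rw [hone _ (Finset.erase_subset _ _), mul_one]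
      have hyk := hy k
      by_cases hk : y k < q
      · rw [Set.indicator_of_mem (show y k ∈ Set.Iio q from hk)]
        have heq : 1 + (n * y k - ρ) * (1 / (x + ρ)) = (x + n * y k) / (x + ρ) := by
          field_simp; ring
        rw [heq]
        refine le_min ?_ le_rfl
        rw [div_le_one hxρ]
        have : n * y k ≤ n * q := by gcongr
        linarith
      · rw [Set.indicator_of_notMem (by simpa using hk)]
        exact le_min zero_le_one (by positivity)
    have hsum := Finset.sum_le_sum hle
    -- Jensen's inequality by hand: a sum of minima is at most either sum, and the `n * y k` add up
    -- to `n` times the total gain.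
    rw [mul_min_of_nonneg _ _ hn'.le, mul_one]
    refine le_min (hsum.trans ?_) (hsum.trans ?_)
    · refine (Finset.sum_le_sum fun k _ => min_le_left _ _).trans ?_
      simp
    · refine (Finset.sum_le_sum fun k _ => min_le_right _ _).trans (le_of_eq ?_)
      rw [← Finset.sum_div, Finset.sum_add_distrib, ← Finset.mul_sum]
      simp only [Finset.sum_const, Finset.card_range, nsmul_eq_mul]
      ring
  · push Not at hall
    obtain ⟨i, hi, hia⟩ := hall
    rw [Finset.sum_eq_zero, mul_zero]
    · refine mul_nonneg (Finset.prod_nonneg fun j _ =>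
        Set.indicator_nonneg (fun _ _ => zero_le_one) _) (le_min zero_le_one ?_)
      have := Finset.sum_nonneg fun j (_ : j ∈ Finset.range n) => hy j
      positivity
    · intro k _
      by_cases hik : i = k
      · subst hik
        rw [Set.indicator_of_notMem (by simpa using hqa.trans hia), zero_mul]
      · rw [prod_indicator_Iio_eq_zero (Finset.mem_erase.2 ⟨hik, hi⟩) hia, mul_zero]

end PatternBound

/-! ### Pathwise analysis of the protocols -/

namespace RelayLink

variable (L : RelayLink)

theorem rpow_d₁_pos : 0 < L.d₁ ^ L.m := Real.rpow_pos_of_pos L.d₁_pos _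

theorem rpow_d₂_pos : 0 < L.d₂ ^ L.m := Real.rpow_pos_of_pos L.d₂_pos _

theorem aBar_pos : 0 < L.aBar :=
  div_pos (mul_pos (mul_pos L.γo_pos L.rpow_d₁_pos) L.varR_pos) L.Ps_pos

theorem bBar_pos : 0 < L.bBar :=
  div_pos (mul_pos (mul_pos L.γo_pos L.rpow_d₂_pos) L.varD_pos) L.Pr_pos

/-- The source-to-relay gain at which harvesting for the whole block time collects the energy
spent by the relay in half a block. -/
noncomputable def rho : ℝ := L.d₁ ^ L.m * L.Pr / (2 * L.η * L.Ps)

theorem two_mul_η_mul_Ps_pos : 0 < 2 * L.η * L.Ps :=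
  mul_pos (mul_pos two_pos L.η_pos) L.Ps_pos

theorem rho_pos : 0 < L.rho :=
  div_pos (mul_pos L.rpow_d₁_pos L.Pr_pos) L.two_mul_η_mul_Ps_pos

theorem snrRelay_lt_iff (z : ℂ) : L.snrRelay z < L.γo ↔ ‖z‖ ^ 2 < L.aBar := by
  rw [snrRelay, aBar, div_lt_iff₀ (mul_pos L.rpow_d₁_pos L.varR_pos), lt_div_iff₀ L.Ps_pos,
    mul_comm L.Ps, mul_assoc L.γo]

theorem snrDest_lt_iff (z : ℂ) : L.snrDest z < L.γo ↔ ‖z‖ ^ 2 < L.bBar := by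
  rw [snrDest, bBar, div_lt_iff₀ (mul_pos L.rpow_d₂_pos L.varD_pos), lt_div_iff₀ L.Pr_pos,
    mul_comm L.Pr, mul_assoc L.γo]

theorem one_sub_outageInd (z : ℂ) :
    1 - L.outageInd z = (Set.Ici L.bBar).indicator (fun _ => 1) (‖z‖ ^ 2) := by
  simp only [outageInd, L.snrDest_lt_iff]
  split_ifs with hz
  · rw [Set.indicator_of_notMem (by simpa using hz), sub_self]
  · rw [Set.indicator_of_mem (by simpa using hz), sub_zero]

theorem harvestFraction_nonneg (E : ℝ) (z : ℂ) : 0 ≤ L.harvestFraction E z := by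
  rw [harvestFraction]
  split_ifs with h1 h2
  · exact zero_le_one
  · exact le_rfl
  · have := L.rpow_d₁_pos
    have := L.Ps_pos
    have := L.η_pos
    have := L.T_pos
    have := L.Pr_pos
    have h3 : 0 ≤ (L.Pr * L.T - 2 * E) * L.d₁ ^ L.m :=
      mul_nonneg (by linarith) L.rpow_d₁_pos.le
    exact div_nonneg (by linarith) (by positivity)

theorem harvestFraction_antitone (z : ℂ) : Antitone fun E => L.harvestFraction E z := by
  intro E E' hE
  by_cases h1 : L.snrRelay z < L.γo
  · simp [harvestFraction, h1]
  by_cases h2 : L.Pr * L.T / 2 ≤ E'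
  · have : L.harvestFraction E' z = 0 := by simp [harvestFraction, h1, h2]
    simpa only [this] using L.harvestFraction_nonneg E z
  · have h3 : ¬ L.Pr * L.T / 2 ≤ E := fun h => h2 (h.trans hE)
    simp only [harvestFraction, if_neg h1, if_neg h2, if_neg h3]
    have := L.rpow_d₁_pos
    have := L.Ps_pos
    have := L.η_pos
    have := L.T_pos
    have := L.Pr_pos
    gcongr

theorem harvestFraction_le_one {E : ℝ} (hE : 0 ≤ E) (z : ℂ) : L.harvestFraction E z ≤ 1 := by
  refine (L.harvestFraction_antitone z hE).trans ?_
  simp only [harvestFraction]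
  have := L.rpow_d₁_pos
  have := L.Ps_pos
  have := L.η_pos
  have := L.T_pos
  have := L.Pr_pos
  split_ifs with h1 h2
  · exact le_rfl
  · exact zero_le_one
  · refine div_le_one_of_le₀ ?_ (by positivity)
    have : 0 ≤ 2 * L.η * L.Ps * ‖z‖ ^ 2 * L.T := by positivity
    linarith

/-- With `S` the accumulated squared gain, the partial harvesting fraction is `(ρ - S) / (‖z‖² +
ρ)`; when the stored energy already suffices, the first entry of the minimum applies. -/
theorem min_one_div_le_one_sub_harvestFraction {z : ℂ} (hz : L.aBar ≤ ‖z‖ ^ 2) (S : ℝ) :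
    min 1 ((‖z‖ ^ 2 + S) / (‖z‖ ^ 2 + L.rho)) ≤
      1 - L.harvestFraction (L.η * L.Ps / L.d₁ ^ L.m * L.T * S) z := by
  have h1 : ¬ L.snrRelay z < L.γo := by rw [L.snrRelay_lt_iff]; exact not_lt.2 hz
  by_cases h2 : L.Pr * L.T / 2 ≤ L.η * L.Ps / L.d₁ ^ L.m * L.T * S
  · simp [harvestFraction, h1, h2]
  · refine (min_le_right _ _).trans (le_of_eq ?_)
    simp only [harvestFraction, if_neg h1, if_neg h2]
    have := L.rpow_d₁_pos
    have := L.Ps_pos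
    have := L.η_pos
    have := L.T_pos
    have := L.Pr_pos
    have := L.rho_pos
    have h4 : 2 * L.η * L.Ps * ‖z‖ ^ 2 * L.T + L.d₁ ^ L.m * L.Pr * L.T =
        2 * L.η * L.Ps * L.T * (‖z‖ ^ 2 + L.rho) := by
      rw [rho]; field_simp
    have h5 : L.d₁ ^ L.m * L.Pr * L.T -
        2 * (L.η * L.Ps / L.d₁ ^ L.m * L.T * S) * L.d₁ ^ L.m =
        2 * L.η * L.Ps * L.T * (L.rho - S) := by
      rw [rho]; field_simp
    rw [h4, h5, mul_div_mul_left _ _ (by positivity)]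
    field_simp
    ring

theorem blockThroughput_nonneg {E : ℝ} (hE : 0 ≤ E) (z w : ℂ) : 0 ≤ L.blockThroughput E z w := by
  rw [blockThroughput, one_sub_outageInd]
  have := L.harvestFraction_le_one hE z
  exact div_nonneg (mul_nonneg (Set.indicator_nonneg (fun _ _ => zero_le_one) _) (by linarith))
    two_pos.le

theorem blockThroughput_le_half (E : ℝ) (z w : ℂ) : L.blockThroughput E z w ≤ 1 / 2 := by
  rw [blockThroughput, one_sub_outageInd]
  have h1 := L.harvestFraction_nonneg E z
  have h2 : (Set.Ici L.bBar).indicator (fun _ => (1 : ℝ)) (‖w‖ ^ 2) ≤ 1 :=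
    Set.indicator_apply_le' (fun _ => le_rfl) fun _ => zero_le_one
  have h3 : 0 ≤ (Set.Ici L.bBar).indicator (fun _ => (1 : ℝ)) (‖w‖ ^ 2) :=
    Set.indicator_nonneg (fun _ _ => zero_le_one) _
  nlinarith

theorem blockThroughput_mono (z w : ℂ) : Monotone fun E => L.blockThroughput E z w := by
  intro E E' hE
  have h1 := L.harvestFraction_antitone z hE
  have h3 : 0 ≤ (Set.Ici L.bBar).indicator (fun _ => (1 : ℝ)) (‖w‖ ^ 2) :=
    Set.indicator_nonneg (fun _ _ => zero_le_one) _
  simp only [blockThroughput, one_sub_outageInd]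
  simp only at h1
  gcongr

theorem harvestedEnergy_nonneg (z : ℂ) : 0 ≤ L.η * L.Ps * ‖z‖ ^ 2 / L.d₁ ^ L.m * L.T := by
  have := L.rpow_d₁_pos
  have := L.Ps_pos
  have := L.η_pos
  have := L.T_pos
  positivity

theorem energyStep_nonneg {E : ℝ} (hE : 0 ≤ E) (z : ℂ) : 0 ≤ L.energyStep E z := by
  have := L.harvestedEnergy_nonneg z
  rw [energyStep]
  split_ifs <;> linarith

theorem energyStepReset_nonneg {E : ℝ} (hE : 0 ≤ E) (z : ℂ) : 0 ≤ L.energyStepReset E z := by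
  have := L.harvestedEnergy_nonneg z
  rw [energyStepReset]
  split_ifs <;> linarith

theorem energyStepReset_le_energyStep {E E' : ℝ} (hE : E ≤ E') (z : ℂ) :
    L.energyStepReset E z ≤ L.energyStep E' z := by
  rw [energyStepReset, energyStep]
  split_ifs <;> linarith

theorem energy_nonneg {step : ℝ → ℂ → ℝ} (hstep : ∀ E, 0 ≤ E → ∀ z, 0 ≤ step E z) (h : ℕ → ℂ)
    {E₀ : ℝ} (hE₀ : 0 ≤ E₀) (i : ℕ) : 0 ≤ energy step h E₀ i := by
  induction i with
  | zero => exact hE₀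
  | succ i ih => exact hstep _ ih _

theorem energy_reset_le_energy (h : ℕ → ℂ) (E₀ : ℝ) (i : ℕ) :
    energy L.energyStepReset h E₀ i ≤ energy L.energyStep h E₀ i := by
  induction i with
  | zero => exact le_rfl
  | succ i ih => exact L.energyStepReset_le_energyStep ih _

/-- The transmission in block `p` empties the battery, so all earlier history is forgotten. Hence
nothing need be known about the joint law of `E₀` and the gains. -/
theorem energy_reset_of_pattern (h : ℕ → ℂ) (E₀ : ℝ) {p : ℕ} (hp : L.aBar ≤ ‖h p‖ ^ 2) {n : ℕ}
    (hn : ∀ j < n, ‖h (p + (j + 1))‖ ^ 2 < L.aBar) :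
    energy L.energyStepReset h E₀ (p + (n + 1)) =
      L.η * L.Ps / L.d₁ ^ L.m * L.T * ∑ j ∈ Finset.range n, ‖h (p + (j + 1))‖ ^ 2 := by
  induction n with
  | zero =>
    change L.energyStepReset _ (h p) = _
    rw [energyStepReset, if_neg (by rw [L.snrRelay_lt_iff]; exact not_lt.2 hp)]
    simp
  | succ n ih =>
    change L.energyStepReset (energy L.energyStepReset h E₀ (p + (n + 1))) (h (p + (n + 1))) = _
    rw [ih fun j hj => hn j (by omega), energyStepReset,
      if_pos ((L.snrRelay_lt_iff _).2 (hn n (by omega))), Finset.sum_range_succ]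
    ring

/-- Lower bound for the throughput of block `p + n + 1` on the event that blocks
`p + 1, …, p + n` are a maximal run of relay outages. -/
noncomputable def patternThroughput (h g : ℕ → ℂ) (p n : ℕ) : ℝ :=
  1 / 2 * ((Set.Ici L.bBar).indicator (fun _ => 1) (‖g (p + (n + 1))‖ ^ 2) *
    ((Set.Ici L.aBar).indicator (fun _ => 1) (‖h p‖ ^ 2) *
      patternBound L.aBar L.rho (L.q n) n (fun j => ‖h (p + (j + 1))‖ ^ 2)
        (‖h (p + (n + 1))‖ ^ 2)))

theorem q_le_aBar (n : ℕ) : L.q n ≤ L.aBar := by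
  rw [q]
  split_ifs
  · exact le_rfl
  · exact min_le_left _ _

theorem mul_q_le_rho (n : ℕ) : n * L.q n ≤ L.rho := by
  by_cases hn : n = 0
  · simpa [hn] using L.rho_pos.le
  · have hn' : (0 : ℝ) < n := by positivity
    rw [q, if_neg hn, mul_comm, ← le_div_iff₀ hn']
    refine (min_le_right _ _).trans (le_of_eq ?_)
    rw [rho, div_div]

theorem q_nonneg (n : ℕ) : 0 ≤ L.q n := by
  have := L.aBar_pos
  have := L.rpow_d₁_pos
  have := L.Pr_pos
  have := L.two_mul_η_mul_Ps_pos
  rw [q]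
  split_ifs
  · exact L.aBar_pos.le
  · exact le_min L.aBar_pos.le (by positivity)

theorem patternThroughput_nonneg (h g : ℕ → ℂ) (p n : ℕ) : 0 ≤ L.patternThroughput h g p n :=
  mul_nonneg (by norm_num) (mul_nonneg (Set.indicator_nonneg (fun _ _ => zero_le_one) _)
    (mul_nonneg (Set.indicator_nonneg (fun _ _ => zero_le_one) _)
      (patternBound_nonneg L.aBar_pos L.rho_pos fun _ => sq_nonneg _)))

/-- If block `p` is in outage, its indicator vanishes; if the run is broken, `patternBound` is
squeezed between 0 and a product of outage indicators that contains a zero. -/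
theorem patternThroughput_eq_zero (h g : ℕ → ℂ) (p n : ℕ)
    (hpn : ¬ (L.aBar ≤ ‖h p‖ ^ 2 ∧ ∀ j < n, ‖h (p + (j + 1))‖ ^ 2 < L.aBar)) :
    L.patternThroughput h g p n = 0 := by
  rw [patternThroughput]
  by_cases hp : L.aBar ≤ ‖h p‖ ^ 2
  · have : ∃ j < n, L.aBar ≤ ‖h (p + (j + 1))‖ ^ 2 := by
      by_contra! hcon
      exact hpn ⟨hp, hcon⟩
    obtain ⟨j, hj, hja⟩ := this
    have hle := patternBound_le (x := ‖h (p + (n + 1))‖ ^ 2) L.aBar_pos L.rho_pos (L.q_le_aBar n)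
      (L.mul_q_le_rho n) (y := fun j => ‖h (p + (j + 1))‖ ^ 2) fun _ => sq_nonneg _
    rw [prod_indicator_Iio_eq_zero (y := fun j => ‖h (p + (j + 1))‖ ^ 2)
      (Finset.mem_range.2 hj) hja, zero_mul] at hle
    rw [le_antisymm hle (patternBound_nonneg L.aBar_pos L.rho_pos fun _ => sq_nonneg _)]
    simp
  · rw [Set.indicator_of_notMem (s := Set.Ici L.aBar) (by simpa using hp)]
    simp

theorem patternThroughput_le_blockThroughput (h g : ℕ → ℂ) {E₀ : ℝ} (hE₀ : 0 ≤ E₀) (p n : ℕ) :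
    L.patternThroughput h g p n ≤ L.blockThroughput
      (energy L.energyStepReset h E₀ (p + (n + 1))) (h (p + (n + 1))) (g (p + (n + 1))) := by
  have hE := energy_nonneg (fun E hE z => L.energyStepReset_nonneg hE z) h hE₀ (p + (n + 1))
  by_cases hpn : L.aBar ≤ ‖h p‖ ^ 2 ∧ ∀ j < n, ‖h (p + (j + 1))‖ ^ 2 < L.aBar
  · rw [patternThroughput, blockThroughput, one_sub_outageInd,
      Set.indicator_of_mem (s := Set.Ici L.aBar) hpn.1, one_mul, mul_comm (1 / 2),
      ← div_eq_mul_one_div]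
    gcongr
    · exact Set.indicator_nonneg (fun _ _ => zero_le_one) _
    refine (patternBound_le L.aBar_pos L.rho_pos (L.q_le_aBar n)
      (L.mul_q_le_rho n) fun _ => sq_nonneg _).trans ?_
    rw [prod_indicator_Iio_eq_one (y := fun j => ‖h (p + (j + 1))‖ ^ 2)
      fun j hj => hpn.2 j (Finset.mem_range.1 hj), one_mul]
    refine Set.indicator_apply_le' (fun hx => ?_) fun _ => ?_
    · rw [L.energy_reset_of_pattern h E₀ hpn.1 hpn.2]
      exact L.min_one_div_le_one_sub_harvestFraction hx _
    · exact sub_nonneg.2 (L.harvestFraction_le_one hE _)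
  · rw [L.patternThroughput_eq_zero h g p n hpn]
    exact L.blockThroughput_nonneg hE _ _

/-- At most one summand is nonzero, because `n` is determined by the last transmitting block before
`i`. The condition `N ≤ i` keeps the truncated subtraction honest. -/
theorem sum_patternThroughput_le_blockThroughput (h g : ℕ → ℂ) {E₀ : ℝ} (hE₀ : 0 ≤ E₀)
    {N i : ℕ} (hN : N ≤ i) :
    ∑ n ∈ Finset.range N, L.patternThroughput h g (i - (n + 1)) n ≤
      L.blockThroughput (energy L.energyStepReset h E₀ i) (h i) (g i) := by
  by_cases hex : ∃ n < N, L.patternThroughput h g (i - (n + 1)) n ≠ 0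
  · obtain ⟨n, hn, hne⟩ := hex
    rw [Finset.sum_eq_single n]
    · have := L.patternThroughput_le_blockThroughput h g hE₀ (i - (n + 1)) n
      rwa [Nat.sub_add_cancel (by omega : n + 1 ≤ i)] at this
    · intro k hk hkn
      rw [Finset.mem_range] at hk
      by_contra hke
      have hn' := not_imp_comm.1 (L.patternThroughput_eq_zero h g (i - (n + 1)) n) hne
      have hk' := not_imp_comm.1 (L.patternThroughput_eq_zero h g (i - (k + 1)) k) hke
      -- The transmitting block that opens the shorter pattern would lie inside the outage run of
      -- the longer one.
      rcases lt_or_gt_of_ne hkn with hlt | hlt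
      · have := hn'.2 (n - k - 1) (by omega)
        rw [show i - (n + 1) + (n - k - 1 + 1) = i - (k + 1) by omega] at this
        exact absurd hk'.1 (not_le.2 this)
      · have := hk'.2 (k - n - 1) (by omega)
        rw [show i - (k + 1) + (k - n - 1 + 1) = i - (n + 1) by omega] at this
        exact absurd hn'.1 (not_le.2 this)
    · intro h; simp [hn] at h
  · push Not at hex
    rw [Finset.sum_eq_zero fun n hn => hex n (Finset.mem_range.1 hn)]
    exact L.blockThroughput_nonneg
      (energy_nonneg (fun E hE z => L.energyStepReset_nonneg hE z) h hE₀ i) _ _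

end RelayLink

/-! ### Boundedness, measurability and integrability -/

section BoundedMeasurable

variable {Ω : Type*} [MeasurableSpace Ω]

/-- Bounded measurable real functions. -/
def BoundedMeasurable (X : Ω → ℝ) : Prop := Measurable X ∧ ∃ c, ∀ ω, |X ω| ≤ c

theorem BoundedMeasurable.mul {X Y : Ω → ℝ} (hX : BoundedMeasurable X)
    (hY : BoundedMeasurable Y) : BoundedMeasurable fun ω => X ω * Y ω := by
  obtain ⟨hXm, c, hc⟩ := hX
  obtain ⟨hYm, d, hd⟩ := hY
  refine ⟨hXm.mul hYm, c * d, fun ω => ?_⟩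
  rw [abs_mul]
  exact mul_le_mul (hc ω) (hd ω) (abs_nonneg _) ((abs_nonneg _).trans (hc ω))

theorem BoundedMeasurable.prod {ι : Type*} {X : ι → Ω → ℝ} (s : Finset ι)
    (hX : ∀ j, BoundedMeasurable (X j)) : BoundedMeasurable fun ω => ∏ j ∈ s, X j ω := by
  classical
  induction s using Finset.induction_on with
  | empty => exact ⟨by simp, 1, by simp⟩
  | insert j s hj ih => simpa [Finset.prod_insert hj] using (hX j).mul ih

theorem BoundedMeasurable.integrable {P : Measure Ω} [IsFiniteMeasure P] {X : Ω → ℝ}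
    (hX : BoundedMeasurable X) : Integrable X P := by
  obtain ⟨hXm, c, hc⟩ := hX
  exact Integrable.of_bound hXm.aestronglyMeasurable c (Eventually.of_forall hc)

/-- The bound is asked only on `u ≥ 0` because the affine factor `n u - ρ`, cut off at `u < q`, is
unbounded for negative `u`. -/
theorem BoundedMeasurable.comp_sq_norm {f : ℝ → ℝ} (hf : Measurable f) {c : ℝ}
    (hc : ∀ u, 0 ≤ u → |f u| ≤ c) {z : Ω → ℂ} (hz : Measurable z) :
    BoundedMeasurable fun ω => f (‖z ω‖ ^ 2) :=
  ⟨hf.comp (by fun_prop), c, fun ω => hc _ (sq_nonneg _)⟩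

theorem abs_indicator_one_le (s : Set ℝ) (u : ℝ) : |s.indicator (fun _ => (1 : ℝ)) u| ≤ 1 := by
  by_cases hu : u ∈ s <;> simp [hu]

end BoundedMeasurable

namespace RelayLink

variable (L : RelayLink)

section Measurability

theorem measurable_snrRelay : Measurable L.snrRelay := by
  unfold snrRelay; fun_prop

theorem measurable_snrDest : Measurable L.snrDest := by
  unfold snrDest; fun_prop

theorem measurable_energyStep : Measurable fun x : ℝ × ℂ => L.energyStep x.1 x.2 := by
  unfold energyStep
  refine Measurable.ite (measurableSet_lt (L.measurable_snrRelay.comp measurable_snd)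
    measurable_const) (by fun_prop) ?_
  exact Measurable.ite (measurableSet_le measurable_const measurable_fst) (by fun_prop)
    (by fun_prop)

theorem measurable_energyStepReset : Measurable fun x : ℝ × ℂ => L.energyStepReset x.1 x.2 := by
  unfold energyStepReset
  exact Measurable.ite (measurableSet_lt (L.measurable_snrRelay.comp measurable_snd)
    measurable_const) (by fun_prop) (by fun_prop)

theorem measurable_harvestFraction : Measurable fun x : ℝ × ℂ => L.harvestFraction x.1 x.2 := by
  unfold harvestFraction
  refine Measurable.ite (measurableSet_lt (L.measurable_snrRelay.comp measurable_snd)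
    measurable_const) (by fun_prop) ?_
  exact Measurable.ite (measurableSet_le measurable_const measurable_fst) (by fun_prop)
    (by fun_prop)

theorem measurable_outageInd : Measurable L.outageInd := by
  unfold outageInd
  exact Measurable.ite (measurableSet_lt L.measurable_snrDest measurable_const) (by fun_prop)
    (by fun_prop)

variable {Ω : Type*} [MeasurableSpace Ω] {h g : ℕ → Ω → ℂ} {E₀ : Ω → ℝ}

theorem measurable_energy {step : ℝ → ℂ → ℝ} (hstep : Measurable fun x : ℝ × ℂ => step x.1 x.2)
    (h_meas : ∀ i, Measurable (h i)) (E₀_meas : Measurable E₀) (i : ℕ) :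
    Measurable fun ω => energy step (fun j => h j ω) (E₀ ω) i := by
  induction i with
  | zero => exact E₀_meas
  | succ i ih => exact hstep.comp (ih.prodMk (h_meas i))

theorem boundedMeasurable_blockThroughput {step : ℝ → ℂ → ℝ}
    (hstep : Measurable fun x : ℝ × ℂ => step x.1 x.2)
    (hstep_nonneg : ∀ E, 0 ≤ E → ∀ z, 0 ≤ step E z)
    (h_meas : ∀ i, Measurable (h i)) (g_meas : ∀ i, Measurable (g i))
    (E₀_meas : Measurable E₀) (E₀_nonneg : ∀ ω, 0 ≤ E₀ ω) (i : ℕ) :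
    BoundedMeasurable fun ω =>
      L.blockThroughput (energy step (fun j => h j ω) (E₀ ω) i) (h i ω) (g i ω) := by
  refine ⟨?_, 1 / 2, fun ω => ?_⟩
  · unfold blockThroughput
    exact ((measurable_const.sub (L.measurable_outageInd.comp (g_meas i))).mul
      (measurable_const.sub (L.measurable_harvestFraction.comp
        ((measurable_energy hstep h_meas E₀_meas i).prodMk (h_meas i))))).div_const 2
  · rw [abs_of_nonneg (L.blockThroughput_nonneg
      (energy_nonneg hstep_nonneg _ (E₀_nonneg ω) i) _ _)]
    exact L.blockThroughput_le_half _ _ _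

end Measurability

/-! ### The terms of the series in normal form -/

section BoundTerm

theorem exponent_div (n : ℕ) :
    (L.d₁ ^ L.m * L.Pr - 2 * L.η * L.Ps * (((n : ℝ) - 1) * L.aBar + L.q n)) / (2 * L.η * L.Ps) =
      L.rho - ((n : ℝ) - 1) * L.aBar - L.q n := by
  have := L.Ps_pos
  have := L.η_pos
  rw [rho]; field_simp; ring

theorem argument_div :
    (L.d₁ ^ L.m * L.Pr + 2 * L.η * L.Ps * L.aBar) / (2 * L.η * L.Ps) = L.rho + L.aBar := by
  have := L.Ps_pos
  have := L.η_pos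
  rw [rho]; field_simp

theorem rpow_d₁_mul_Pr : L.d₁ ^ L.m * L.Pr = 2 * L.η * L.Ps * L.rho := by
  have := L.Ps_pos
  have := L.η_pos
  rw [rho]; field_simp

theorem one_sub_exp_neg_aBar_pos : 0 < 1 - Real.exp (-L.aBar) :=
  sub_pos.2 (Real.exp_lt_one_iff.2 (neg_lt_zero.2 L.aBar_pos))

theorem exp_aBar_sub_one : Real.exp L.aBar - 1 = Real.exp L.aBar * (1 - Real.exp (-L.aBar)) := by
  rw [mul_sub, ← Real.exp_add]; simp

/-- The negative powers for `n = 0` disappear because `q 0 = ā`: each meets a matching factor `1 -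
e^{-ā}` or `e^{ā} - 1`. -/
theorem boundTerm_zero : L.boundTerm 0 = 2 * L.η * L.Ps *
    (Real.exp (-L.aBar) - L.rho * (Real.exp L.rho * expIntegralE1 (L.rho + L.aBar))) := by
  have hr := L.one_sub_exp_neg_aBar_pos.ne'
  have hq : L.q 0 = L.aBar := by simp [q]
  rw [boundTerm, exponent_div, argument_div, rpow_d₁_mul_Pr, hq]
  have he : Real.exp (L.rho - (((0 : ℕ) : ℝ) - 1) * L.aBar - L.aBar) = Real.exp L.rho := by
    congr 1; push_cast; ring
  have hz : ((0 : ℕ) : ℤ) - 1 = -1 := by norm_num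
  have hne : Real.exp L.aBar ≠ 0 := Real.exp_ne_zero _
  have h2 : 2 * ((0 : ℕ) : ℝ) * L.η * L.Ps * L.aBar - 2 * L.η * L.Ps * L.rho +
      2 * ((0 : ℕ) : ℝ) * L.η * L.Ps +
      (2 * L.η * L.Ps * L.rho - 2 * ((0 : ℕ) : ℝ) * L.η * L.Ps) * Real.exp L.aBar =
      2 * L.η * L.Ps * L.rho * (Real.exp L.aBar - 1) := by push_cast; ring
  have hr' : Real.exp L.aBar - 1 ≠ 0 := by rw [exp_aBar_sub_one]; exact mul_ne_zero hne hr
  rw [he, hz, zpow_neg_one, zpow_neg_one, h2]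
  field_simp

/-- The factor `e^{-(n-1)ā}` hidden in the exponent combines with `(e^{ā} - 1)^{n-1}` into the
probability `(1 - e^{-ā})^{n-1}` of `n - 1` outages. -/
theorem boundTerm_succ (k : ℕ) : L.boundTerm (k + 1) = 2 * L.η * L.Ps *
    ((1 - Real.exp (-L.aBar)) ^ k * ((1 - Real.exp (-L.q (k + 1))) * Real.exp (-L.aBar) +
      (((k + 1 : ℕ) : ℝ) * (1 - Real.exp (-L.q (k + 1)) - L.q (k + 1) * Real.exp (-L.q (k + 1))) -
        L.rho * (1 - Real.exp (-L.q (k + 1)))) *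
        (Real.exp L.rho * expIntegralE1 (L.rho + L.aBar)))) := by
  rw [boundTerm, exponent_div, argument_div, rpow_d₁_mul_Pr, exp_aBar_sub_one]
  have hz : ((k + 1 : ℕ) : ℤ) - 1 = (k : ℕ) := by push_cast; ring
  have he : Real.exp (L.rho - (((k + 1 : ℕ) : ℝ) - 1) * L.aBar - L.q (k + 1)) =
      Real.exp L.rho * (Real.exp L.aBar ^ k)⁻¹ * Real.exp (-L.q (k + 1)) := by
    rw [← Real.exp_nat_mul, ← Real.exp_neg, ← Real.exp_add, ← Real.exp_add]
    congr 1; push_cast; ring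
  have hne : Real.exp L.aBar ^ k ≠ 0 := pow_ne_zero _ (Real.exp_ne_zero _)
  rw [he, hz, zpow_natCast, zpow_natCast, mul_pow, Real.exp_neg (L.q (k + 1))]
  have hq := Real.exp_ne_zero (L.q (k + 1))
  field_simp
  ring

end BoundTerm

/-! ### The mean contribution of one pattern -/

section PatternMean

variable {Ω : Type*} [MeasurableSpace Ω] {P : Measure Ω} [IsProbabilityMeasure P]
  {h g : ℕ → Ω → ℂ}

theorem integrable_and_integral_patternThroughput
    (h_meas : ∀ i, Measurable (h i)) (g_meas : ∀ i, Measurable (g i))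
    (h_law : ∀ i, P.map (h i) = stdComplexGaussian)
    (g_law : ∀ i, P.map (g i) = stdComplexGaussian)
    (h_g_indep : iIndepFun (Sum.elim h g : ℕ ⊕ ℕ → Ω → ℂ) P) (p n : ℕ) :
    Integrable (fun ω => L.patternThroughput (fun j => h j ω) (fun j => g j ω) p n) P ∧
    ∫ ω, L.patternThroughput (fun j => h j ω) (fun j => g j ω) p n ∂P =
      Real.exp (-(L.aBar + L.bBar)) / (4 * L.η * L.Ps) * L.boundTerm n := by
  have ha := L.aBar_pos
  have hρ := L.rho_pos
  have hη := L.η_pos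
  have hPs := L.Ps_pos
  set G : ℝ → ℝ := (Set.Ici L.bBar).indicator fun _ => 1 with hG
  set W : ℝ → ℝ := (Set.Ici L.aBar).indicator fun _ => 1 with hW
  set D : ℝ → ℝ := (Set.Ici L.aBar).indicator fun u => 1 / (u + L.rho) with hD
  set w : ℝ → ℝ := (Set.Iio L.aBar).indicator fun _ => 1 with hw
  have Gm : Measurable G := measurable_const.indicator measurableSet_Ici
  have Wm : Measurable W := measurable_const.indicator measurableSet_Ici
  have wm : Measurable w := measurable_const.indicator measurableSet_Iio
  have Dm : Measurable D := Measurable.indicator (by fun_prop) measurableSet_Ici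
  have Db : ∀ u, 0 ≤ u → |D u| ≤ 1 / L.rho := fun u hu => by
    by_cases hu' : u ∈ Set.Ici L.aBar
    · rw [hD, Set.indicator_of_mem hu', abs_of_nonneg (by positivity)]
      gcongr
      linarith
    · rw [hD, Set.indicator_of_notMem hu', abs_zero]
      positivity
  have hGe : expMean G = Real.exp (-L.bBar) := expMean_indicator_Ici_one L.bBar_pos
  have hWe : expMean W = Real.exp (-L.aBar) := expMean_indicator_Ici_one ha
  have hDe : expMean D = Real.exp L.rho * expIntegralE1 (L.rho + L.aBar) :=
    expMean_indicator_Ici_one_div ha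
  have hwe : expMean w = 1 - Real.exp (-L.aBar) := expMean_indicator_Iio_one ha.le
  have hint : ∀ (u : ℝ → ℝ) (V : ℕ → ℝ → ℝ), Measurable u → (∃ c, ∀ x, 0 ≤ x → |u x| ≤ c) →
      (∀ j, Measurable (V j)) → (∀ j, ∃ c, ∀ x, 0 ≤ x → |V j x| ≤ c) →
      Integrable (fun ω => G (‖g (p + (n + 1)) ω‖ ^ 2) * (W (‖h p ω‖ ^ 2) *
        (∏ j ∈ Finset.range n, V j (‖h (p + (j + 1)) ω‖ ^ 2)) *
          u (‖h (p + (n + 1)) ω‖ ^ 2))) P := by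
    rintro u V hu ⟨c, hc⟩ hV hVb
    refine (BoundedMeasurable.mul (.comp_sq_norm Gm (fun u _ => abs_indicator_one_le _ u)
      (g_meas _)) (.mul (.mul (.comp_sq_norm Wm (fun u _ => abs_indicator_one_le _ u)
      (h_meas _)) (.prod _ fun j => ?_)) (.comp_sq_norm hu hc (h_meas _)))).integrable
    obtain ⟨d, hd⟩ := hVb j
    exact .comp_sq_norm (hV j) hd (h_meas _)
  have hmean : ∀ (u : ℝ → ℝ) (V : ℕ → ℝ → ℝ), Measurable u → (∀ j, Measurable (V j)) →
      ∫ ω, G (‖g (p + (n + 1)) ω‖ ^ 2) * (W (‖h p ω‖ ^ 2) *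
        (∏ j ∈ Finset.range n, V j (‖h (p + (j + 1)) ω‖ ^ 2)) *
          u (‖h (p + (n + 1)) ω‖ ^ 2)) ∂P =
        Real.exp (-(L.aBar + L.bBar)) * ((∏ j ∈ Finset.range n, expMean (V j)) * expMean u) := by
    intro u V hu hV
    rw [integral_pattern_gains h_meas g_meas h_law g_law h_g_indep Gm Wm hu hV, hGe, hWe,
      neg_add, Real.exp_add]
    ring
  have Wb : ∃ c, ∀ x, 0 ≤ x → |W x| ≤ c := ⟨1, fun x _ => abs_indicator_one_le _ x⟩
  have wb : ∃ c, ∀ x, 0 ≤ x → |w x| ≤ c := ⟨1, fun x _ => abs_indicator_one_le _ x⟩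
  rcases n with _ | k
  · have hrw : ∀ ω, L.patternThroughput (fun j => h j ω) (fun j => g j ω) p 0 =
        1 / 2 * (G (‖g (p + (0 + 1)) ω‖ ^ 2) * (W (‖h p ω‖ ^ 2) *
          (∏ j ∈ Finset.range 0, w (‖h (p + (j + 1)) ω‖ ^ 2)) * W (‖h (p + (0 + 1)) ω‖ ^ 2)) -
        L.rho * (G (‖g (p + (0 + 1)) ω‖ ^ 2) * (W (‖h p ω‖ ^ 2) *
          (∏ j ∈ Finset.range 0, w (‖h (p + (j + 1)) ω‖ ^ 2)) *
            D (‖h (p + (0 + 1)) ω‖ ^ 2)))) := by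
      intro ω
      rw [patternThroughput, patternBound, if_pos rfl, Finset.prod_range_zero]
      ring
    have i1 := hint W (fun _ => w) Wm Wb (fun _ => wm) fun _ => wb
    have i2 := (hint D (fun _ => w) Dm ⟨_, Db⟩ (fun _ => wm) fun _ => wb).const_mul L.rho
    simp_rw [hrw]
    refine ⟨(i1.sub i2).const_mul _, ?_⟩
    rw [integral_const_mul, integral_sub i1 i2, integral_const_mul,
      hmean W (fun _ => w) Wm fun _ => wm, hmean D (fun _ => w) Dm fun _ => wm, boundTerm_zero,
      hWe, hDe]
    simp only [Finset.range_zero, Finset.prod_empty]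
    field_simp
    ring
  · set q := L.q (k + 1) with hq
    have hq0 : 0 ≤ q := L.q_nonneg _
    set N : ℝ := ((k + 1 : ℕ) : ℝ) with hN
    have hN0 : 0 < N := by rw [hN]; positivity
    set v₁ : ℝ → ℝ := (Set.Iio q).indicator fun _ => 1 with hv₁
    set v₂ : ℝ → ℝ := (Set.Iio q).indicator fun u => N * u - L.rho with hv₂
    have v₁m : Measurable v₁ := measurable_const.indicator measurableSet_Iio
    have v₂m : Measurable v₂ := Measurable.indicator (by fun_prop) measurableSet_Iio
    have v₁e : expMean v₁ = 1 - Real.exp (-q) := expMean_indicator_Iio_one hq0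
    have v₂e : expMean v₂ = _ := expMean_indicator_Iio_affine hq0 N L.rho
    have v₂b : ∀ x, 0 ≤ x → |v₂ x| ≤ N * q + L.rho := fun x hx => by
      by_cases hx' : x ∈ Set.Iio q
      · rw [hv₂, Set.indicator_of_mem hx', abs_le]
        have h1 : N * x ≤ N * q := by gcongr; exact (Set.mem_Iio.1 hx').le
        have h2 : 0 ≤ N * x := by positivity
        constructor <;> linarith
      · rw [hv₂, Set.indicator_of_notMem hx', abs_zero]
        positivity
    have hVm : ∀ (i : ℕ) {v : ℝ → ℝ}, Measurable v → ∀ j, Measurable (if j = i then v else w) :=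
      fun i v hv j => by split_ifs <;> assumption
    have hVb : ∀ (i : ℕ) {v : ℝ → ℝ}, (∃ c, ∀ x, 0 ≤ x → |v x| ≤ c) →
        ∀ j, ∃ c, ∀ x, 0 ≤ x → |(if j = i then v else w) x| ≤ c :=
      fun i v hv j => by split_ifs <;> assumption
    -- One factor is marked and the other `k` are plain outage probabilities. The value does not
    -- depend on the marked index, so the average over it collapses.
    have hVe : ∀ i ∈ Finset.range (k + 1), ∀ v : ℝ → ℝ,
        ∏ j ∈ Finset.range (k + 1), expMean (if j = i then v else w) =
          expMean v * (1 - Real.exp (-L.aBar)) ^ k := by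
      intro i hi v
      rw [← Finset.mul_prod_erase _ _ hi, if_pos rfl, Finset.prod_congr rfl fun j hj => by
        rw [if_neg (Finset.ne_of_mem_erase hj), hwe], Finset.prod_const,
        Finset.card_erase_of_mem hi, Finset.card_range, Nat.add_sub_cancel]
    have hrw : ∀ ω, L.patternThroughput (fun j => h j ω) (fun j => g j ω) p (k + 1) =
        1 / 2 * (N⁻¹ * ∑ i ∈ Finset.range (k + 1),
          (G (‖g (p + (k + 1 + 1)) ω‖ ^ 2) * (W (‖h p ω‖ ^ 2) *
            (∏ j ∈ Finset.range (k + 1), (if j = i then v₁ else w) (‖h (p + (j + 1)) ω‖ ^ 2)) *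
              W (‖h (p + (k + 1 + 1)) ω‖ ^ 2)) +
          G (‖g (p + (k + 1 + 1)) ω‖ ^ 2) * (W (‖h p ω‖ ^ 2) *
            (∏ j ∈ Finset.range (k + 1), (if j = i then v₂ else w) (‖h (p + (j + 1)) ω‖ ^ 2)) *
              D (‖h (p + (k + 1 + 1)) ω‖ ^ 2)))) := by
      intro ω
      rw [patternThroughput, patternBound, if_neg (Nat.succ_ne_zero k)]
      congr 1
      rw [mul_left_comm _ N⁻¹, mul_left_comm _ N⁻¹, Finset.mul_sum, Finset.mul_sum]
      congr 1
      refine Finset.sum_congr rfl fun i _ => ?_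
      ring
    have i1 := fun i : ℕ => hint W (fun j => if j = i then v₁ else w) Wm Wb (hVm i v₁m)
      (hVb i ⟨1, fun x _ => abs_indicator_one_le _ x⟩)
    have i2 := fun i : ℕ => hint D (fun j => if j = i then v₂ else w) Dm ⟨_, Db⟩ (hVm i v₂m)
      (hVb i ⟨_, v₂b⟩)
    simp_rw [hrw]
    refine ⟨((integrable_finsetSum _ fun i _ => (i1 i).add (i2 i)).const_mul _).const_mul _, ?_⟩
    rw [integral_const_mul, integral_const_mul,
      integral_finsetSum _ fun i _ => (i1 i).fun_add (i2 i), boundTerm_succ]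
    have hterm : ∀ i ∈ Finset.range (k + 1), _ := fun i hi =>
      (integral_add (i1 i) (i2 i)).trans (by
        rw [hmean W _ Wm (hVm i v₁m), hmean D _ Dm (hVm i v₂m), hVe i hi, hVe i hi])
    rw [Finset.sum_congr rfl hterm, Finset.sum_const, Finset.card_range, nsmul_eq_mul, ← hN, v₁e,
      v₂e, hWe, hDe, ← hq]
    field_simp
    ring

end PatternMean

end RelayLink

/-! ### Passage to the long-run throughput -/

theorem theorem3 (L : RelayLink) {Ω : Type*} [MeasurableSpace Ω] (P : Measure Ω)
    [IsProbabilityMeasure P] (h g : ℕ → Ω → ℂ)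
    (h_meas : ∀ i, Measurable (h i)) (g_meas : ∀ i, Measurable (g i))
    (h_law : ∀ i, P.map (h i) = stdComplexGaussian)
    (g_law : ∀ i, P.map (g i) = stdComplexGaussian)
    (h_g_indep : iIndepFun (Sum.elim h g : ℕ ⊕ ℕ → Ω → ℂ) P)
    (E₀ : Ω → ℝ) (E₀_meas : Measurable E₀) (E₀_nonneg : ∀ ω, 0 ≤ E₀ ω) :
    Summable L.boundTerm ∧
    Real.exp (-(L.aBar + L.bBar)) / (4 * L.η * L.Ps) * ∑' n : ℕ, L.boundTerm n ≤
      L.throughput L.energyStepReset P h g E₀ ∧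
    L.throughput L.energyStepReset P h g E₀ ≤ L.throughput L.energyStep P h g E₀ := by
  have hreset := L.boundedMeasurable_blockThroughput L.measurable_energyStepReset
    (fun E hE z => L.energyStepReset_nonneg hE z) h_meas g_meas E₀_meas E₀_nonneg
  have hkeep := L.boundedMeasurable_blockThroughput L.measurable_energyStep
    (fun E hE z => L.energyStep_nonneg hE z) h_meas g_meas E₀_meas E₀_nonneg
  have hpat := L.integrable_and_integral_patternThroughput h_meas g_meas h_law g_law h_g_indep
  have hC : 0 < Real.exp (-(L.aBar + L.bBar)) / (4 * L.η * L.Ps) :=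
    div_pos (Real.exp_pos _) (mul_pos (mul_pos four_pos L.η_pos) L.Ps_pos)
  set C := Real.exp (-(L.aBar + L.bBar)) / (4 * L.η * L.Ps)
  set τ := fun (step : ℝ → ℂ → ℝ) (i : ℕ) => ∫ ω, L.blockThroughput
    (RelayLink.energy step (fun j => h j ω) (E₀ ω) i) (h i ω) (g i ω) ∂P with hτ
  have hle_half : ∀ {step}, (∀ i, BoundedMeasurable fun ω => L.blockThroughput
      (RelayLink.energy step (fun j => h j ω) (E₀ ω) i) (h i ω) (g i ω)) →
      ∀ i, τ step i ≤ 1 / 2 := fun hm i => by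
    refine (integral_mono (hm i).integrable (integrable_const (1 / 2)) fun ω =>
      L.blockThroughput_le_half _ _ _).trans ?_
    simp
  have hterm_nonneg : ∀ n, 0 ≤ C * L.boundTerm n := fun n => by
    rw [← (hpat 0 n).2]
    exact integral_nonneg fun ω => L.patternThroughput_nonneg _ _ _ _
  have hpartial : ∀ N i, N ≤ i →
      ∑ n ∈ Finset.range N, C * L.boundTerm n ≤ τ L.energyStepReset i := by
    intro N i hN
    -- The mean of a pattern does not depend on its starting block, so the `n`-th one may start at
    -- `i - (n + 1)`, making all of them end at block `i`.
    rw [← Finset.sum_congr rfl fun n _ => (hpat (i - (n + 1)) n).2,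
      ← integral_finsetSum _ fun n _ => (hpat (i - (n + 1)) n).1]
    exact integral_mono (integrable_finsetSum _ fun n _ => (hpat (i - (n + 1)) n).1)
      (hreset i).integrable fun ω =>
        L.sum_patternThroughput_le_blockThroughput _ _ (E₀_nonneg ω) hN
  have hsum : Summable fun n => C * L.boundTerm n :=
    summable_of_sum_range_le hterm_nonneg fun N =>
      (hpartial N N le_rfl).trans (hle_half hreset N)
  -- A real `liminf` is meaningful only for suitably bounded sequences; the bound `1/2` supplies
  -- this.
  have hcob : ∀ {step}, (∀ i, τ step i ≤ 1 / 2) →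
      IsCoboundedUnder (· ≥ ·) atTop (τ step) := fun hs =>
    (isBoundedUnder_of ⟨1 / 2, hs⟩ : IsBoundedUnder (· ≤ ·) atTop _).isCoboundedUnder_ge
  refine ⟨(summable_mul_left_iff hC.ne').1 hsum, ?_, ?_⟩
  · rw [← tsum_mul_left]
    refine Real.tsum_le_of_sum_range_le hterm_nonneg fun N => ?_
    exact le_liminf_of_le (hcob (hle_half hreset))
      ((eventually_ge_atTop N).mono fun i hi => hpartial N i hi)
  · refine liminf_le_liminf (Eventually.of_forall fun i => ?_) ?_ (hcob (hle_half hkeep))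
    · exact integral_mono (hreset i).integrable (hkeep i).integrable fun ω =>
        L.blockThroughput_mono _ _ (L.energy_reset_le_energy _ _ i)
    · exact isBoundedUnder_of ⟨0, fun i => integral_nonneg fun ω => L.blockThroughput_nonneg
        (RelayLink.energy_nonneg (fun E hE z => L.energyStepReset_nonneg hE z) _
          (E₀_nonneg ω) i) _ _⟩
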